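/- Let $k$ be a field. A *variety* over $k$ is a separated scheme of finite type over $k$; it is not assumed to be reduced. For irreducible varieties $X,Y$ over $k$, a *birational transformation* $X\dashrightarrow Y$ is given by an isomorphism of $k$-schemes from a dense open subscheme of $X$ onto a dense open subscheme of $Y$, two such isomorphisms being identified when they agree on some dense open subscheme of $X$; these can be composed, and $\mathrm{Bir}(X)$ denotes the group of birational transformations $X\dashrightarrow X$. A group $G$ has *Property FW* if for every $G$-set $E$ and every subset $A\subset E$ such that $A\smallsetminus g^{-1}A$ is finite for all $g\in G$, there exists a $G$-invariant subset $T\subset E$ such that the symmetric difference $T\,\triangle\, A$ is finite. **Theorem 1.1.** Let $X$ be an irreducible variety over $k$, let $G$ be a group with Property FW, and let $\varphi\colon G\to\mathrm{Bir}(X)$ be a group homomorphism (a birational action of $G$ on $X$). Then there exist an irreducible variety $Y$ over $k$, a group homomorphism $\rho\colon G\to\mathrm{Aut}_k(Y)$ (a biregular action of $G$ on $Y$), and a birational transformation $u\colon X\dashrightarrow Y$ which is $G$-equivariant, i.e. $u\circ\varphi(g)=\rho(g)\circ u$ as birational transformations $X\dashrightarrow Y$ for all $g\in G$. -/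

import Mathlib

open CategoryTheory AlgebraicGeometry

universe u v w

/-! ### Property FW -/

section PropertyFW

open scoped Pointwise

/-- A subset `A` of a `G`-set is commensurated if `A ∖ g⁻¹A` is finite for every `g`. -/
def IsCommensurated (G : Type v) [Group G] {E : Type w} [MulAction G E] (A : Set E) : Prop :=
  ∀ g : G, (A \ g⁻¹ • A).Finite

/-- A subset `A` of a `G`-set is transfixed if it differs from some `G`-invariant subset by a
finite set. -/
def IsTransfixed (G : Type v) [Group G] {E : Type w} [MulAction G E] (A : Set E) : Prop :=
  ∃ T : Set E, (∀ g : G, g • T = T) ∧ (symmDiff T A).Finite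

/-- `G` has Property FW if in every `G`-set every commensurated subset is transfixed. The
`G`-sets range over a universe `w`; as long as it is at least the universe of `G`, the choice of
`w` does not matter, since transfixedness is decided on countable unions of orbits. -/
def PropertyFW (G : Type v) [Group G] : Prop :=
  ∀ (E : Type w) [MulAction G E] (A : Set E), IsCommensurated G A → IsTransfixed G A

end PropertyFW

/-! ### Varieties -/

/-- A scheme over a field `k` is a variety if it is locally of finite type, separated and
quasi-compact (so noetherian). It need be neither reduced nor irreducible. -/
structure IsVariety {k : Type u} [Field k] {X : Scheme.{u}}
    (s : X ⟶ Spec (CommRingCat.of k)) : Prop where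
  locallyOfFiniteType : LocallyOfFiniteType s
  isSeparated : IsSeparated s
  quasiCompact : QuasiCompact s

/-! ### Birational transformations -/

section Birational

variable {S X Y Z T : Scheme.{u}}

/-- A birational transformation over `S` from `X` to `Y`: a rational map (class of morphisms on
dense open subschemes, modulo agreement on a dense open subscheme) which is represented by an
isomorphism over `S` between a dense open subscheme of `X` and one of `Y`. -/
@[ext]
structure BirationalMap (sX : X ⟶ S) (sY : Y ⟶ S) where
  toRationalMap : X ⤏ Y
  exists_partialIso :
    ∃ p : X.PartialIso Y, p.IsOver sX sY ∧ p.toRationalMap = toRationalMap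

namespace BirationalMap

theorem isDominant_partialIso (p : X.PartialIso Y) : p.toRationalMap.IsDominant := by
  have := Opens.isDominant_ι p.dense_target
  have : IsDominant (p.iso.hom ≫ p.target.ι) := inferInstance
  exact (p.toPartialMap.isDominant_toRationalMap_iff).2 this

instance isDominant {sX : X ⟶ S} {sY : Y ⟶ S} (f : BirationalMap sX sY) :
    f.toRationalMap.IsDominant := by
  obtain ⟨p, -, h⟩ := f.exists_partialIso
  rw [← h]
  exact isDominant_partialIso p

theorem comp_eq_of_factor [IrreducibleSpace X] [IrreducibleSpace Y]
    (f : X.PartialMap Y) (g : Y.PartialMap Z) (h : X.PartialMap Z) [f.toRationalMap.IsDominant]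
    (W : X.Opens) (hW : Dense (W : Set X)) (hf : W ≤ f.domain) (hh : W ≤ h.domain)
    (a : W.toScheme ⟶ g.domain.toScheme) (h1 : X.homOfLE hf ≫ f.hom = a ≫ g.domain.ι)
    (h2 : X.homOfLE hh ≫ h.hom = a ≫ g.hom) :
    f.toRationalMap.comp g.toRationalMap = h.toRationalMap := by
  have : IsDominant f.hom := (f.isDominant_toRationalMap_iff).1 inferInstance
  rw [Scheme.RationalMap.toRationalMap_comp]
  refine Scheme.PartialMap.toRationalMap_eq_iff.2 ?_
  have hle : W ≤ f.domain.ι ''ᵁ f.hom ⁻¹ᵁ g.domain := by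
    intro x hx
    refine ⟨⟨x, hf hx⟩, ?_, rfl⟩
    change f.hom.base ⟨x, hf hx⟩ ∈ g.domain
    have h3 : f.hom (X.homOfLE hf ⟨x, hx⟩) = g.domain.ι (a ⟨x, hx⟩) :=
      congrArg (fun t : W.toScheme ⟶ Y => t ⟨x, hx⟩) h1
    have h4 : X.homOfLE hf ⟨x, hx⟩ = ⟨x, hf hx⟩ := Subtype.ext (by simp)
    have h5 : f.hom ⟨x, hf hx⟩ = (a ⟨x, hx⟩).1 := (congrArg f.hom h4).symm.trans h3
    change f.hom ⟨x, hf hx⟩ ∈ g.domain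
    rw [h5]
    exact (a ⟨x, hx⟩).2
  refine ⟨W, hW, hle, hh, ?_⟩
  have key : X.homOfLE hle ≫ (f.domain.ι.isoImage _).inv ≫ f.hom ∣_ g.domain = a := by
    rw [← cancel_mono g.domain.ι, ← h1]
    simp only [Category.assoc, morphismRestrict_ι]
    have : X.homOfLE hle ≫ (f.domain.ι.isoImage (f.hom ⁻¹ᵁ g.domain)).inv ≫
      (f.hom ⁻¹ᵁ g.domain).ι = X.homOfLE hf := by
      rw [← cancel_mono f.domain.ι]
      simp
    rw [← this]
    simp
  change X.homOfLE hle ≫ (f.domain.ι.isoImage _).inv ≫ f.hom ∣_ g.domain ≫ g.hom =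
    X.homOfLE hh ≫ h.hom
  rw [h2, ← key]
  simp

theorem restrictSource_hom (p : X.PartialIso Y) (U : X.Opens)
    (hU : Dense (U : Set X)) (hU' : U ≤ p.source) :
    (p.restrictSource U hU hU').iso.hom ≫ (p.restrictSource U hU hU').target.ι =
      X.homOfLE hU' ≫ p.iso.hom ≫ p.target.ι := by
  have : (Scheme.Opens.isoOfLE hU').inv ≫ (p.source.ι ⁻¹ᵁ U).ι = X.homOfLE hU' := by
    rw [← cancel_mono p.source.ι]; simp
  simp [Scheme.PartialIso.restrictSource, ← reassoc_of% this]

theorem iso_swap (p : X.PartialIso Y) {V : X.Opens} {U : Y.Opens} (e : V.toScheme ≅ U.toScheme)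
    (hV : V ≤ p.source) (hU : U ≤ p.target)
    (A : e.inv ≫ V.ι = Y.homOfLE hU ≫ p.iso.inv ≫ p.source.ι) :
    X.homOfLE hV ≫ p.iso.hom = e.hom ≫ Y.homOfLE hU := by
  have B : e.inv ≫ X.homOfLE hV = Y.homOfLE hU ≫ p.iso.inv := by
    rw [← cancel_mono p.source.ι]
    simpa using A
  rw [← cancel_epi e.inv, reassoc_of% B]
  simp

theorem comp_eq_of_isos [IrreducibleSpace X] [IrreducibleSpace Y]
    {sX : X ⟶ S} {sY : Y ⟶ S} {sZ : Z ⟶ S}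
    (p : X.PartialIso Y) (q : Y.PartialIso Z) [p.toRationalMap.IsDominant]
    (hp : p.IsOver sX sY) (hq : q.IsOver sY sZ)
    {V : X.Opens} {U : Y.Opens} {W : Z.Opens} (dV : Dense (V : Set X)) (dW : Dense (W : Set Z))
    (hV : V ≤ p.source) (hU : U ≤ p.target) (hU' : U ≤ q.source)
    (e : V.toScheme ≅ U.toScheme) (e' : U.toScheme ≅ W.toScheme)
    (h1 : X.homOfLE hV ≫ p.iso.hom = e.hom ≫ Y.homOfLE hU)
    (h2 : e'.hom ≫ W.ι = Y.homOfLE hU' ≫ q.iso.hom ≫ q.target.ι) :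
    ∃ r : X.PartialIso Z, r.IsOver sX sZ ∧
      r.toRationalMap = p.toRationalMap.comp q.toRationalMap := by
  refine ⟨⟨V, dV, W, dW, e ≪≫ e'⟩, ?_, Eq.symm ?_⟩
  · change (e.hom ≫ e'.hom) ≫ W.ι ≫ sZ = V.ι ≫ sX
    have h3 : e.hom ≫ Y.homOfLE hU ≫ p.target.ι = X.homOfLE hV ≫ p.iso.hom ≫ p.target.ι := by
      rw [reassoc_of% h1]
    rw [Category.assoc, reassoc_of% h2, hq, Scheme.homOfLE_ι_assoc]
    rw [← Y.homOfLE_ι hU, Category.assoc, reassoc_of% h3, hp, Scheme.homOfLE_ι_assoc]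
  refine comp_eq_of_factor _ _ _ V dV hV le_rfl (e.hom ≫ Y.homOfLE hU') ?_ ?_
  · change X.homOfLE hV ≫ p.iso.hom ≫ p.target.ι = (e.hom ≫ Y.homOfLE hU') ≫ q.source.ι
    rw [reassoc_of% h1]
    simp
  · change X.homOfLE le_rfl ≫ (e.hom ≫ e'.hom) ≫ W.ι =
      (e.hom ≫ Y.homOfLE hU') ≫ q.iso.hom ≫ q.target.ι
    rw [Category.assoc, h2]
    simp

theorem exists_partialIso_comp [IrreducibleSpace X] [IrreducibleSpace Y]
    {sX : X ⟶ S} {sY : Y ⟶ S} {sZ : Z ⟶ S}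
    (p : X.PartialIso Y) (q : Y.PartialIso Z) [p.toRationalMap.IsDominant]
    (hp : p.IsOver sX sY) (hq : q.IsOver sY sZ) :
    ∃ r : X.PartialIso Z, r.IsOver sX sZ ∧
      r.toRationalMap = p.toRationalMap.comp q.toRationalMap := by
  have hd := p.dense_target.inter_of_isOpen_right q.dense_source q.source.2
  let p' := p.symm.restrictSource (p.target ⊓ q.source) hd inf_le_left
  let q' := q.restrictSource (p.target ⊓ q.source) hd inf_le_right
  have hp' : p'.target ≤ p.source := by
    rintro _ ⟨y, -, rfl⟩
    exact y.2
  have h1 := iso_swap p p'.iso.symm hp' inf_le_left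
    (restrictSource_hom p.symm (p.target ⊓ q.source) hd inf_le_left)
  exact comp_eq_of_isos p q hp hq p'.dense_target q'.dense_target hp' inf_le_left inf_le_right
    p'.iso.symm q'.iso h1 (restrictSource_hom q (p.target ⊓ q.source) hd inf_le_right)

theorem comp_symm_partialIso [IrreducibleSpace X] [IrreducibleSpace Y]
    (p : X.PartialIso Y) [p.toRationalMap.IsDominant] :
    p.toRationalMap.comp p.symm.toRationalMap = Scheme.RationalMap.id X := by
  refine comp_eq_of_factor _ _ _ p.source p.dense_source le_rfl le_top p.iso.hom ?_ ?_
  · have hD : X.homOfLE (le_refl p.source) = 𝟙 _ := by simp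
    exact congrArg (· ≫ _) hD |>.trans (Category.id_comp _)
  · change X.homOfLE le_top ≫ X.topIso.hom ≫ 𝟙 X = p.iso.hom ≫ p.iso.inv ≫ p.source.ι
    simp

theorem exists_partialIso_of_iso {sX : X ⟶ S} {sY : Y ⟶ S} (e : X ≅ Y) (he : e.hom ≫ sY = sX) :
    ∃ p : X.PartialIso Y, p.IsOver sX sY ∧ p.toRationalMap = e.hom.toRationalMap := by
  have h : (X.topIso.hom ≫ e.hom ≫ Y.topIso.inv) ≫ (⊤ : Y.Opens).ι = X.topIso.hom ≫ e.hom := by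
    rw [← Y.topIso_hom]
    simp
  refine ⟨Scheme.PartialIso.ofIso e, ?_, ?_⟩
  · change (X.topIso.hom ≫ e.hom ≫ Y.topIso.inv) ≫ (⊤ : Y.Opens).ι ≫ sY = (⊤ : X.Opens).ι ≫ sX
    rw [← Category.assoc, h, Category.assoc, he, Scheme.topIso_hom]
  · exact congrArg (fun t => Scheme.PartialMap.toRationalMap ⟨⊤, dense_univ, t⟩) h

/-- The identity, as a birational transformation. -/
def id (sX : X ⟶ S) : BirationalMap sX sX where
  toRationalMap := Scheme.RationalMap.id X
  exists_partialIso := exists_partialIso_of_iso (Iso.refl X) (Category.id_comp sX)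

/-- Composition `g ∘ f` of birational transformations `f : X ⇢ Y` and `g : Y ⇢ Z`. -/
noncomputable def comp [IrreducibleSpace X] [IrreducibleSpace Y]
    {sX : X ⟶ S} {sY : Y ⟶ S} {sZ : Z ⟶ S}
    (f : BirationalMap sX sY) (g : BirationalMap sY sZ) : BirationalMap sX sZ where
  toRationalMap := f.toRationalMap.comp g.toRationalMap
  exists_partialIso := by
    obtain ⟨f, p, hp, rfl⟩ := f
    obtain ⟨g, q, hq, rfl⟩ := g
    have := isDominant_partialIso p
    exact exists_partialIso_comp p q hp hq

theorem exists_inverse [IrreducibleSpace X] [IrreducibleSpace Y] {sX : X ⟶ S} {sY : Y ⟶ S}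
    (f : BirationalMap sX sY) :
    ∃ g : BirationalMap sY sX, f.comp g = id sX := by
  obtain ⟨f, p, hp, rfl⟩ := f
  have := isDominant_partialIso p
  exact ⟨⟨_, p.symm, hp.symm, rfl⟩, BirationalMap.ext (comp_symm_partialIso p)⟩

/-- An isomorphism over `S`, as a birational transformation. -/
def ofIso {sX : X ⟶ S} {sY : Y ⟶ S} (e : Over.mk sX ≅ Over.mk sY) : BirationalMap sX sY where
  toRationalMap := e.hom.left.toRationalMap
  exists_partialIso :=
    exists_partialIso_of_iso ((Over.forget S).mapIso e) (Over.w e.hom)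

end BirationalMap

/-- The group of birational transformations of an irreducible scheme `X` over `S`. -/
abbrev Bir (sX : X ⟶ S) : Type u := BirationalMap sX sX

/-- The product `f * g` in the group of birational transformations is `f ∘ g`. -/
noncomputable instance [IrreducibleSpace X] (sX : X ⟶ S) : Group (Bir sX) :=
  { mul f g := g.comp f
    one := BirationalMap.id sX
    inv f := f.exists_inverse.choose
    mul_assoc _ _ _ := BirationalMap.ext (Scheme.RationalMap.comp_assoc _ _ _).symm
    one_mul _ := BirationalMap.ext (Scheme.RationalMap.comp_id _)
    mul_one _ := BirationalMap.ext (Scheme.RationalMap.id_comp _)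
    inv_mul_cancel f := f.exists_inverse.choose_spec }

end Birational

/-!
The scheme `Y` is found inside a scheme `Z`, the `globalization`, on which the whole group
`Bir(X)` acts by automorphisms. It is glued from one copy of a dense affine open subscheme `A` of
`X` for every birational transformation `b`, the copies for `b` and `c` being identified along the
open subschemes of `A` between which `c⁻¹ b` restricts to an isomorphism. As `X` may be
nonreduced, `A` has to avoid the embedded components of `X` (`IsGermDetermined`): then a morphism
between open subschemes of `A` is determined by the rational map it represents
(`IsGermDetermined.hom_ext`), and the copies form a locally directed diagram of open immersions.
The scheme `Z` is irreducible and locally of finite type, of bounded dimension, but in general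
neither quasi-compact nor separated. The inclusion of `A` is a `Bir(X)`-equivariant birational
transformation from `X` to `Z` (`globalization.comp_ofOpen`).

Property FW repairs quasi-compactness (`exists_open_stable`). Given a noetherian open set `U`
containing the generic point and stable under `G` at points of codimension less than `i`, the
points of codimension `i` in `U \ g⁻¹U` are generic points of its irreducible components, hence
finite in number. So the points of codimension `i` in `U` form a commensurated subset, and
Property FW says that it becomes `G`-invariant after changing finitely many points; `U` is changed
accordingly. As codimensions are bounded, finitely many steps turn `A` into a `G`-stable
noetherian open set.

Separatedness is then obtained by shrinking (`exists_stable_separating_open`): the union `Y` of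
the translates of the intersection of a finite affine cover of this open set is stable, and any
two of its points lie in a common affine open subscheme of `Z`, which forces `Y` to be separated.
-/

open TopologicalSpace Limits

/-! ### Property FW across universes -/

/-- Property FW tested in the universe `max u v` can be applied to `G`-sets in the universe `u`,
here to the points of a scheme. -/
theorem PropertyFW.isTransfixed {G : Type v} [Group G] (hG : PropertyFW.{v, max u v} G)
    {E : Type u} [MulAction G E] {A : Set E} (hA : IsCommensurated G A) : IsTransfixed G A := by
  have hc : IsCommensurated G (ULift.down.{v} ⁻¹' A) := by
    intro g
    refine ((hA g).preimage (ULift.down_injective.injOn)).subset ?_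
    rintro x ⟨hx, hgx⟩
    refine ⟨hx, fun h ↦ hgx ?_⟩
    rw [Set.mem_inv_smul_set_iff] at h ⊢
    exact h
  obtain ⟨T, hT, hfin⟩ := hG (ULift.{v} E) _ hc
  refine ⟨ULift.up ⁻¹' T, fun g ↦ ?_, ?_⟩
  · ext x
    rw [Set.mem_smul_set_iff_inv_smul_mem, Set.mem_preimage, Set.mem_preimage]
    conv_rhs => rw [← hT g, Set.mem_smul_set_iff_inv_smul_mem]
    rfl
  · exact hfin.preimage (f := ULift.up) ULift.up_injective.injOn

/-! ### Making an open set stable, one codimension at a time -/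

section Topology

open scoped Pointwise

variable {Z : Type u} [TopologicalSpace Z]

theorem Set.Finite.mem_closure_iff_exists_specializes {B : Set Z} (hB : B.Finite) {x : Z} :
    x ∈ closure B ↔ ∃ b ∈ B, b ⤳ x := by
  rw [← Set.biUnion_of_singleton B, hB.closure_biUnion]
  simp [specializes_iff_mem_closure]

/-- If `c` is strictly increasing under proper specialization (like the codimension of the closure
of a point) and is at least `i` on the noetherian locally closed set `U \ O`, then `c` takes the
value `i` at only finitely many points of `U \ O`: they are generic points of its irreducible
components. -/
theorem finite_minimal_codim_of_noetherianSpace [QuasiSober Z] {c : Z → ℕ}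
    (hc : ∀ x y, x ⤳ y → x ≠ y → c x < c y) {U O : Set Z} (hU : IsOpen U) [NoetherianSpace U]
    (hO : IsOpen O) {i : ℕ} (hi : ∀ x ∈ U \ O, i ≤ c x) : {x ∈ U \ O | c x = i}.Finite := by
  have : NoetherianSpace ↑(U \ O) := NoetherianSpace.of_subset Set.sdiff_subset
  obtain ⟨S, hS, -, hirr, hun⟩ :=
    NoetherianSpace.exists_finite_set_isClosed_irreducible (α := ↑(U \ O)) isClosed_univ
  have key : ∀ t ∈ S, ∀ x ∈ t, ∀ y ∈ t, c x = i → c y = i → (x : Z) = y := by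
    intro t ht x hx y hy hcx hcy
    -- the generic point `z` of the closure of `t` in the ambient space still lies in `U \ O`, so
    -- that `c z ≥ i` and every point of `t` with `c x = i` is `z`
    have hirr' := ((hirr t ht).image Subtype.val continuous_subtype_val.continuousOn)
    obtain ⟨z, hz⟩ := QuasiSober.sober hirr'.closure isClosed_closure
    have hsp : ∀ x ∈ t, z ⤳ (x : Z) := fun x hx ↦
      hz.specializes (subset_closure (Set.mem_image_of_mem _ hx))
    have hzU : z ∈ U := (hsp x hx).mem_open hU x.2.1
    have hzO : z ∉ O := by
      intro h
      obtain ⟨_, h1, a, -, rfl⟩ := mem_closure_iff.1 hz.mem O hO h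
      exact a.2.2 h1
    have huniq : ∀ x ∈ t, c x = i → (x : Z) = z := by
      intro x hx hcx
      by_contra hne
      have := hc z x (hsp x hx) (Ne.symm hne)
      have := hi z ⟨hzU, hzO⟩
      omega
    rw [huniq x hx hcx, huniq y hy hcy]
  have hsub : {x ∈ U \ O | c x = i} ⊆ ⋃ t ∈ S, {x : Z | ∃ y ∈ t, y.1 = x ∧ c x = i} := by
    rintro x ⟨hx, hcx⟩
    obtain ⟨t, ht, hxt⟩ : (⟨x, hx⟩ : ↑(U \ O)) ∈ ⋃₀ S := hun ▸ Set.mem_univ _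
    exact Set.mem_biUnion ht ⟨_, hxt, rfl, hcx⟩
  refine (hS.biUnion fun t ht ↦ Set.Subsingleton.finite ?_).subset hsub
  rintro _ ⟨x, hx, rfl, hcx⟩ _ ⟨y, hy, rfl, hcy⟩
  exact key t ht x hx y hy hcx hcy

variable {G : Type v} [Group G] [MulAction G Z] [ContinuousConstSMul G Z]

theorem noetherianSpace_preimage_smul (g : G) (U : Set Z) [NoetherianSpace U] :
    NoetherianSpace ↑((g • ·) ⁻¹' U : Set Z) := by
  let f : ↑((g • ·) ⁻¹' U : Set Z) → U := fun x ↦ ⟨g • x.1, x.2⟩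
  have hf : Topology.IsInducing f := by
    have h1 : Topology.IsInducing (Subtype.val ∘ f) :=
      ((Homeomorph.smul g).isInducing).comp Topology.IsInducing.subtypeVal
    exact Topology.IsInducing.of_comp (by fun_prop) continuous_subtype_val h1
  exact hf.noetherianSpace

/-- The induction step. The open set `U` is stable under `G` on points of codimension less than
`i`, so the points of codimension `i` of `U \ g⁻¹U` have minimal codimension there and are finite
in number: the set `A` of points of codimension `i` in `U` is commensurated. Property FW provides
an invariant set `T` differing from `A` by a finite set. The set `U'` is obtained by removing from
`U` the closure of `A \ T` and adding suitable neighbourhoods of the points of `T \ A`; its points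
of codimension `i` are exactly the points of `T`. -/
theorem exists_open_stable_succ [QuasiSober Z]
    (hG : PropertyFW.{v, max u v} G) {c : Z → ℕ}
    (hc : ∀ x y, x ⤳ y → x ≠ y → c x < c y) (hcG : ∀ (g : G) x, c (g • x) = c x)
    {η : Z} {i : ℕ} (hi : c η < i) {U : Set Z} (hU : IsOpen U) [NoetherianSpace U] (hηU : η ∈ U)
    (hst : ∀ (g : G), ∀ x ∈ U, c x < i → g • x ∈ U) :
    ∃ U' : Set Z, IsOpen U' ∧ NoetherianSpace U' ∧ η ∈ U' ∧
      ∀ (g : G), ∀ x ∈ U', c x < i + 1 → g • x ∈ U' := by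
  have hle : ∀ x y, x ⤳ y → c y ≤ c x → x = y := by
    intro x y hxy h
    by_contra hne
    have := hc x y hxy hne
    omega
  let A : Set Z := {x ∈ U | c x = i}
  have hA : IsCommensurated G A := by
    intro g
    refine (finite_minimal_codim_of_noetherianSpace hc hU (hU.preimage (continuous_const_smul g))
      (i := i) ?_).subset ?_
    · rintro x ⟨hx, hgx⟩
      by_contra hlt
      exact hgx (hst g x hx (by omega))
    · rintro x ⟨⟨hxU, hcx⟩, hgx⟩
      refine ⟨⟨hxU, fun h ↦ hgx ?_⟩, hcx⟩
      rw [Set.mem_inv_smul_set_iff]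
      exact ⟨h, (hcG g x).trans hcx⟩
  have hfinA : ∀ g : G, {x : Z | g • x ∈ A ∧ x ∉ A}.Finite := by
    intro g
    refine ((hA g⁻¹).image (g⁻¹ • ·)).subset ?_
    rintro x ⟨h1, h2⟩
    refine ⟨g • x, ⟨h1, fun h ↦ h2 ?_⟩, inv_smul_smul g x⟩
    rwa [inv_inv, Set.smul_mem_smul_set_iff] at h
  obtain ⟨T₀, hT₀, hfin₀⟩ := hG.isTransfixed hA
  -- only points with a translate in `U` have a neighbourhood that is a translate of an open subset
  -- of `U`; this condition is invariant and holds on `A`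
  let T : Set Z := {x ∈ T₀ | c x = i ∧ ∃ g : G, g • x ∈ U}
  have hTG : ∀ (g : G), ∀ x ∈ T, g • x ∈ T := by
    rintro g x ⟨h1, h2, h, h3⟩
    refine ⟨?_, (hcG g x).trans h2, h * g⁻¹, by rwa [smul_smul, inv_mul_cancel_right]⟩
    rw [← hT₀ g]
    exact Set.smul_mem_smul_set h1
  have hAT : ∀ x ∈ A, x ∈ T₀ → x ∈ T := fun x hx h ↦ ⟨h, hx.2, 1, by simpa using hx.1⟩
  have hB : (A \ T).Finite := hfin₀.subset fun x hx ↦ Or.inr ⟨hx.1, fun h ↦ hx.2 (hAT x hx.1 h)⟩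
  have hD : (T \ A).Finite := hfin₀.subset fun x hx ↦ Or.inl ⟨hx.1.1, hx.2⟩
  choose! γ hγ using fun x (hx : x ∈ T) ↦ hx.2.2
  -- the neighbourhood `γ t⁻¹ U` of `t` may contain further points of codimension `i` outside `A`,
  -- but only finitely many; `N t` omits their closure
  let R : Z → Set Z := fun t ↦ {x | γ t • x ∈ A ∧ x ∉ A} \ {t}
  have hR : ∀ t, (R t).Finite := fun t ↦ (hfinA (γ t)).subset Set.sdiff_subset
  let N : Z → Set Z := fun t ↦ ((γ t • ·) ⁻¹' U) \ closure (R t)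
  have hTc : ∀ x ∈ T, c x = i := fun x hx ↦ hx.2.1
  -- a point of codimension at most `i` in the closure of the finite set `A \ T` belongs to `A \ T`
  have hBU : ∀ x, c x ≤ i → x ∈ closure (A \ T) → x ∈ A \ T := by
    intro x hx h
    obtain ⟨b, hb, hbx⟩ := hB.mem_closure_iff_exists_specializes.1 h
    rwa [← hle b x hbx (hx.trans hb.1.2.ge)]
  refine ⟨(U ∪ ⋃ t ∈ T \ A, N t) \ closure (A \ T), ?_, ?_, ⟨Or.inl hηU, fun h ↦ ?_⟩, ?_⟩
  · refine (hU.union (isOpen_biUnion fun t _ ↦ ?_)).sdiff isClosed_closure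
    exact (hU.preimage (continuous_const_smul _)).sdiff isClosed_closure
  · have := hD.to_subtype
    have h1 : ∀ o : Option ↑(T \ A),
        NoetherianSpace ↑(o.elim U fun t ↦ (γ t • ·) ⁻¹' U : Set Z) := by
      rintro (_ | t)
      · assumption
      · exact noetherianSpace_preimage_smul _ _
    have := NoetherianSpace.iUnion (fun o : Option ↑(T \ A) ↦
      (o.elim U fun t ↦ (γ t • ·) ⁻¹' U : Set Z))
    refine NoetherianSpace.of_subset (W := ⋃ o : Option ↑(T \ A),
      (o.elim U fun t ↦ (γ t • ·) ⁻¹' U : Set Z)) ?_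
    rintro x ⟨hx | hx, -⟩
    · exact Set.mem_iUnion.2 ⟨none, hx⟩
    · obtain ⟨t, ht, hx⟩ := Set.mem_iUnion₂.1 hx
      exact Set.mem_iUnion.2 ⟨some ⟨t, ht⟩, hx.1⟩
  · have := (hBU η hi.le h).1.2
    omega
  · rintro g x ⟨hx, hxB⟩ hcx
    have hTU : ∀ y ∈ T, y ∈ (U ∪ ⋃ t ∈ T \ A, N t) \ closure (A \ T) := by
      intro y hy
      refine ⟨?_, fun h ↦ (hBU y (hTc y hy).le h).2 hy⟩
      by_cases hyA : y ∈ A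
      · exact Or.inl hyA.1
      · refine Or.inr (Set.mem_biUnion (show y ∈ T \ A from ⟨hy, hyA⟩) ⟨hγ y hy, fun h ↦ ?_⟩)
        obtain ⟨b, hb, hby⟩ := (hR y).mem_closure_iff_exists_specializes.1 h
        have hcb : c b = i := (hcG (γ y) b).symm.trans hb.1.1.2
        exact hb.2 (hle b y hby ((hTc y hy).le.trans hcb.ge))
    rcases Nat.lt_succ_iff_lt_or_eq.1 hcx with hlt | heq
    · have hxU : x ∈ U := by
        rcases hx with hx | hx
        · exact hx
        · obtain ⟨t, ht, hx⟩ := Set.mem_iUnion₂.1 hx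
          simpa using hst (γ t)⁻¹ _ hx.1 (by rwa [hcG])
      refine ⟨Or.inl (hst g x hxU hlt), fun h ↦ ?_⟩
      have h1 : c (g • x) < i := by rwa [hcG]
      have := (hBU _ h1.le h).1.2
      omega
    · have hxA : x ∈ A → x ∈ T := fun hA ↦ by
        by_contra hT
        exact hxB (subset_closure ⟨hA, hT⟩)
      refine hTU _ (hTG g x ?_)
      rcases hx with hx | hx
      · exact hxA ⟨hx, heq⟩
      · obtain ⟨t, ht, hx⟩ := Set.mem_iUnion₂.1 hx
        by_cases hxA' : x ∈ A
        · exact hxA hxA'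
        · have : x = t := by
            by_contra hne
            exact hx.2 (subset_closure ⟨⟨⟨hx.1, (hcG _ x).trans heq⟩, hxA'⟩, hne⟩)
          exact this ▸ ht.1

/-- For a group with Property FW acting on a sober space of bounded codimension with a generic
point, every noetherian open neighbourhood of the generic point can be modified, one codimension
after the other, into one that is stable under the group. -/
theorem exists_open_stable [QuasiSober Z] [T0Space Z]
    (hG : PropertyFW.{v, max u v} G) {c : Z → ℕ} {n : ℕ} (hn : ∀ x, c x ≤ n)
    (hc : ∀ x y, x ⤳ y → x ≠ y → c x < c y) (hcG : ∀ (g : G) x, c (g • x) = c x)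
    {η : Z} (hη : ∀ x, η ⤳ x) {U : Set Z} (hU : IsOpen U) [NoetherianSpace U] (hηU : η ∈ U) :
    ∃ U' : Set Z, IsOpen U' ∧ NoetherianSpace U' ∧ η ∈ U' ∧ ∀ (g : G), ∀ x ∈ U', g • x ∈ U' := by
  have hgη : ∀ g : G, g • η = η := by
    intro g
    refine (Specializes.antisymm ?_ (hη _)).eq
    simpa using (hη (g⁻¹ • η)).map (continuous_const_smul g)
  have hind : ∀ m : ℕ, ∃ U' : Set Z, IsOpen U' ∧ NoetherianSpace U' ∧ η ∈ U' ∧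
      ∀ (g : G), ∀ x ∈ U', c x < c η + 1 + m → g • x ∈ U' := by
    intro m
    induction m with
    | zero =>
      refine ⟨U, hU, inferInstance, hηU, fun g x hx hcx ↦ ?_⟩
      by_cases h : η = x
      · rwa [← h, hgη]
      · have := hc η x (hη x) h
        omega
    | succ m ih =>
      obtain ⟨U', hU', _, hηU', hst⟩ := ih
      exact exists_open_stable_succ hG hc hcG (i := c η + 1 + m) (by omega) hU' hηU' hst
  obtain ⟨U', hU', hN, hηU', hst⟩ := hind n
  exact ⟨U', hU', hN, hηU', fun g x hx ↦ hst g x hx (by have := hn x; omega)⟩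

end Topology

/-! ### Rational maps and open immersions -/

section RationalMap

variable {S X Y Z : Scheme.{u}}

/-- The rational map represented by a morphism on a dense open subscheme. -/
def rationalMapOf (U : X.Opens) (hU : Dense (U : Set X)) (m : U.toScheme ⟶ Y) : X ⤏ Y :=
  Scheme.PartialMap.toRationalMap ⟨U, hU, m⟩

theorem rationalMapOf_eq_iff {U V : X.Opens} {hU : Dense (U : Set X)} {hV : Dense (V : Set X)}
    {m : U.toScheme ⟶ Y} {n : V.toScheme ⟶ Y} :
    rationalMapOf U hU m = rationalMapOf V hV n ↔
      ∃ (W : X.Opens) (_ : Dense (W : Set X)) (h : W ≤ U) (h' : W ≤ V),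
        X.homOfLE h ≫ m = X.homOfLE h' ≫ n :=
  Scheme.PartialMap.toRationalMap_eq_iff

theorem rationalMapOf_homOfLE_comp {U V : X.Opens} (hU : Dense (U : Set X))
    (hV : Dense (V : Set X)) (h : U ≤ V) (m : V.toScheme ⟶ Y) :
    rationalMapOf U hU (X.homOfLE h ≫ m) = rationalMapOf V hV m :=
  rationalMapOf_eq_iff.2 ⟨U, hU, le_rfl, h, by simp⟩

theorem rationalMapOf_ι (U : X.Opens) (hU : Dense (U : Set X)) :
    rationalMapOf U hU U.ι = Scheme.RationalMap.id X :=
  rationalMapOf_eq_iff.2 ⟨U, hU, le_rfl, le_top, by simp [Scheme.topIso_hom]⟩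

theorem compHom_injective_of_mono (j : Y ⟶ Z) [Mono j] :
    Function.Injective fun f : X ⤏ Y ↦ f.compHom j := by
  intro f g h
  obtain ⟨⟨U, hU, m⟩, rfl⟩ := f.exists_rep
  obtain ⟨⟨V, hV, n⟩, rfl⟩ := g.exists_rep
  obtain ⟨W, hW, h1, h2, e⟩ := rationalMapOf_eq_iff.1 h
  refine rationalMapOf_eq_iff.2 ⟨W, hW, h1, h2, ?_⟩
  rw [← cancel_mono j]
  simpa using e

theorem compHom_compHom (f : X ⤏ Y) (g : Y ⟶ Z) {T : Scheme.{u}} (h : Z ⟶ T) :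
    (f.compHom g).compHom h = f.compHom (g ≫ h) := by
  obtain ⟨f, rfl⟩ := f.exists_rep
  change Scheme.PartialMap.toRationalMap _ = Scheme.PartialMap.toRationalMap _
  congr 1

theorem isDominant_of_isOpenImmersion [Nonempty X] [PreirreducibleSpace Y] (m : X ⟶ Y)
    [IsOpenImmersion m] : IsDominant m :=
  ⟨m.opensRange.2.dense (Set.range_nonempty m)⟩

/-- A rational map factoring through `V`, followed by one defined on `V`. -/
theorem rationalMapOf_comp [IrreducibleSpace X] [IrreducibleSpace Y] {U : X.Opens} {V : Y.Opens}
    (hU : Dense (U : Set X)) (hV : Dense (V : Set Y)) (m : U.toScheme ⟶ V.toScheme)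
    (n : V.toScheme ⟶ Z) [(rationalMapOf U hU (m ≫ V.ι)).IsDominant] :
    (rationalMapOf U hU (m ≫ V.ι)).comp (rationalMapOf V hV n) = rationalMapOf U hU (m ≫ n) := by
  have : (Scheme.PartialMap.toRationalMap ⟨U, hU, m ≫ V.ι⟩ : X ⤏ Y).IsDominant :=
    inferInstanceAs (rationalMapOf U hU (m ≫ V.ι)).IsDominant
  exact BirationalMap.comp_eq_of_factor ⟨U, hU, m ≫ V.ι⟩ ⟨V, hV, n⟩ ⟨U, hU, m ≫ n⟩ U hU le_rfl
    le_rfl m (by simp) (by simp)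

theorem nonempty_of_dense [Nonempty X] {U : X.Opens} (hU : Dense (U : Set X)) :
    Nonempty U.toScheme :=
  let ⟨x, hx⟩ := hU.nonempty
  ⟨⟨x, hx⟩⟩

/-- The birational transformation represented by an open immersion of a dense open subscheme. -/
noncomputable def BirationalMap.ofOpenImmersion [IrreducibleSpace X] [IrreducibleSpace Y]
    {sX : X ⟶ S} {sY : Y ⟶ S} (U : X.Opens) (hU : Dense (U : Set X)) (m : U.toScheme ⟶ Y)
    [IsOpenImmersion m] (h : m ≫ sY = U.ι ≫ sX) : BirationalMap sX sY where
  toRationalMap := rationalMapOf U hU m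
  exists_partialIso := by
    have := nonempty_of_dense hU
    refine ⟨⟨U, hU, m.opensRange, (isDominant_of_isOpenImmersion m).1, m.isoOpensRange⟩, ?_, ?_⟩
    · simp [Scheme.PartialIso.IsOver, h]
    · simp [rationalMapOf, Scheme.PartialIso.toRationalMap, Scheme.PartialIso.toPartialMap]

theorem BirationalMap.exists_eq_rationalMapOf {sX : X ⟶ S} {sY : Y ⟶ S}
    (f : BirationalMap sX sY) :
    ∃ (U : X.Opens) (hU : Dense (U : Set X)) (m : U.toScheme ⟶ Y), IsOpenImmersion m ∧
      m ≫ sY = U.ι ≫ sX ∧ f.toRationalMap = rationalMapOf U hU m := by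
  obtain ⟨p, hp, h⟩ := f.exists_partialIso
  refine ⟨p.source, p.dense_source, p.iso.hom ≫ p.target.ι, inferInstance, ?_, h.symm⟩
  simpa using hp

/-! ### Open subschemes without embedded components -/

/-- An affine open subscheme on which sections are determined by their germs at the generic point
of `X`. For noetherian `X` it amounts to avoiding the embedded components of `X`. -/
class IsGermDetermined [IrreducibleSpace X] (A : X.Opens) : Prop where
  isAffineOpen : IsAffineOpen A
  exists_germ_injective :
    ∃ h : genericPoint X ∈ A, Function.Injective (X.presheaf.germ A (genericPoint X) h)

theorem exists_isGermDetermined (X : Scheme.{u}) [IrreducibleSpace X] [IsLocallyNoetherian X] :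
    ∃ A : X.Opens, IsGermDetermined A := by
  obtain ⟨A, hx, hA, h⟩ := X.exists_germ_injective (genericPoint X)
  exact ⟨A, hA, hx, h⟩

section GermDetermined

variable [IrreducibleSpace X]

theorem genericPoint_mem_of_dense {U : X.Opens} (hU : Dense (U : Set X)) : genericPoint X ∈ U :=
  (genericPoint_specializes _).mem_open U.2 hU.nonempty.choose_spec

namespace IsGermDetermined

variable {A : X.Opens}

theorem dense (hA : IsGermDetermined A) : Dense (A : Set X) :=
  A.2.dense ⟨_, hA.exists_germ_injective.1⟩

/-- Sections over any open subset `U` of `A` are determined by the generic germ: locally, `U` is a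
principal open subset of `A`. -/
theorem germ_injective (hA : IsGermDetermined A) {U : X.Opens} (hU : U ≤ A)
    (h : genericPoint X ∈ U) :
    Function.Injective (X.presheaf.germ U (genericPoint X) h) := by
  intro s t hst
  obtain ⟨hη, hinj⟩ := hA.exists_germ_injective
  refine TopCat.Presheaf.section_ext X.sheaf U s t fun x hx ↦ ?_
  obtain ⟨f, hfU, hxf⟩ := hA.isAffineOpen.exists_basicOpen_le ⟨x, hx⟩ (hU hx)
  have hηf : genericPoint X ∈ X.basicOpen f := (genericPoint_specializes x).mem_open
    (X.basicOpen f).2 hxf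
  have key : X.presheaf.map (homOfLE hfU).op s = X.presheaf.map (homOfLE hfU).op t := by
    apply injective_germ_basicOpen A hA.isAffineOpen _ hη f hηf hinj
    rw [TopCat.Presheaf.germ_res_apply, TopCat.Presheaf.germ_res_apply, hst]
  have := congrArg (X.presheaf.germ _ x hxf) key
  rwa [TopCat.Presheaf.germ_res_apply, TopCat.Presheaf.germ_res_apply] at this

/-- Morphisms between open subschemes of `A` are equal as soon as they agree as rational maps. This
fails on a scheme with embedded components, where morphisms that agree on a dense open subscheme
may differ. -/
theorem hom_ext (hA : IsGermDetermined A) {U V : X.Opens} (hU : U ≤ A) (hV : V ≤ A)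
    (dU : Dense (U : Set X)) {m n : U.toScheme ⟶ V.toScheme}
    (h : rationalMapOf U dU (m ≫ V.ι) = rationalMapOf U dU (n ≫ V.ι)) : m = n := by
  obtain ⟨W, dW, hWU, _, e⟩ := rationalMapOf_eq_iff.1 h
  have : IsAffine A.toScheme := hA.isAffineOpen
  -- after enlarging `V` to the affine `A`, it suffices to compare global sections
  rw [← cancel_mono (X.homOfLE hV)]
  apply ext_of_isAffine
  have e' : X.homOfLE hWU ≫ m ≫ X.homOfLE hV = X.homOfLE hWU ≫ n ≫ X.homOfLE hV := by
    rw [← cancel_mono A.ι]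
    simpa using e
  have e'' := congrArg Scheme.Hom.appTop e'
  rw [Scheme.Hom.comp_appTop, Scheme.Hom.comp_appTop (X.homOfLE hWU), Scheme.homOfLE_appTop] at e''
  ext s
  have hs := ConcreteCategory.congr_hom e'' s
  have hη := genericPoint_mem_of_dense dW
  have hW : genericPoint X ∈ W.ι ''ᵁ (X.homOfLE hWU ⁻¹ᵁ ⊤) := ⟨⟨_, hη⟩, trivial, rfl⟩
  have hU' : genericPoint X ∈ U.ι ''ᵁ ⊤ := ⟨⟨_, hWU hη⟩, trivial, rfl⟩
  apply hA.germ_injective (U := U.ι ''ᵁ ⊤) ((U.ι_image_le ⊤).trans hU) hU'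
  have := congrArg (X.presheaf.germ _ _ hW) hs
  erw [TopCat.Presheaf.germ_res_apply, TopCat.Presheaf.germ_res_apply] at this
  exact this

end IsGermDetermined

end GermDetermined

end RationalMap

/-! ### The charts of the globalization -/

section Chart

variable {S X Y Z : Scheme.{u}}

theorem BirationalMap.comp_toRationalMap_eq [IrreducibleSpace X] [IrreducibleSpace Y]
    {sX : X ⟶ S} {sY : Y ⟶ S} {sZ : Z ⟶ S} (f : BirationalMap sX sY) (g : BirationalMap sY sZ)
    {U : X.Opens} {V : Y.Opens} {hU : Dense (U : Set X)} {hV : Dense (V : Set Y)}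
    {m : U.toScheme ⟶ V.toScheme} {n : V.toScheme ⟶ Z}
    (hf : f.toRationalMap = rationalMapOf U hU (m ≫ V.ι))
    (hg : g.toRationalMap = rationalMapOf V hV n) :
    (f.comp g).toRationalMap = rationalMapOf U hU (m ≫ n) := by
  obtain ⟨f, hf'⟩ := f
  obtain ⟨g, hg'⟩ := g
  subst hf hg
  have : (rationalMapOf U hU (m ≫ V.ι)).IsDominant := BirationalMap.isDominant ⟨_, hf'⟩
  exact rationalMapOf_comp hU hV m n

theorem homOfLE_mem_of_le_image {U V : X.Opens} {W : V.toScheme.Opens} (hU : U ≤ V.ι ''ᵁ W)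
    (h : U ≤ V) (x : U.toScheme) : X.homOfLE h x ∈ W := by
  obtain ⟨w, hw, hx⟩ := hU x.2
  have : X.homOfLE h x = w := Subtype.ext ((Scheme.homOfLE_apply h x).trans hx.symm)
  rwa [this]

/-- A chart of the globalization of the action of `Bir(X)` on `X`: the open subscheme `opens` of
`A`, put in the position of its translate by the birational transformation `elt`. -/
structure Chart (sX : X ⟶ S) (A : X.Opens) where
  /-- The birational transformation by which the open subscheme is translated. -/
  elt : Bir sX
  /-- The open subscheme that is translated. -/
  opens : X.Opens
  le : opens ≤ A
  dense : Dense (opens : Set X)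

namespace Chart

variable [IrreducibleSpace X] {sX : X ⟶ S} {A : X.Opens}

/-- An inclusion of charts `(b, U) ⟶ (c, V)`: an open immersion `U ⟶ V` over `S` which represents
`c⁻¹ * b`. -/
@[ext]
structure Hom (i j : Chart sX A) where
  /-- The underlying open immersion. -/
  hom : i.opens.toScheme ⟶ j.opens.toScheme
  isOpenImmersion : IsOpenImmersion hom
  hom_comp : hom ≫ j.opens.ι ≫ sX = i.opens.ι ≫ sX
  eq : (j.elt⁻¹ * i.elt).toRationalMap = rationalMapOf i.opens i.dense (hom ≫ j.opens.ι)

noncomputable instance : Category (Chart sX A) where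
  Hom := Hom
  id i := ⟨𝟙 _, inferInstance, Category.id_comp _, by
    rw [inv_mul_cancel, Category.id_comp, rationalMapOf_ι]
    rfl⟩
  comp {i j k} f g :=
    { hom := f.hom ≫ g.hom
      isOpenImmersion := by
        have := f.isOpenImmersion
        have := g.isOpenImmersion
        infer_instance
      hom_comp := by rw [Category.assoc, g.hom_comp, f.hom_comp]
      eq := by
        have h : k.elt⁻¹ * i.elt = (k.elt⁻¹ * j.elt) * (j.elt⁻¹ * i.elt) := by group
        rw [h, Category.assoc]
        exact BirationalMap.comp_toRationalMap_eq _ _ f.eq g.eq }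
  id_comp f := Hom.ext (Category.id_comp _)
  comp_id f := Hom.ext (Category.comp_id _)
  assoc f g h := Hom.ext (Category.assoc _ _ _)

variable (sX A) in
/-- The diagram of charts. -/
noncomputable def diagram : Chart sX A ⥤ Scheme.{u} where
  obj i := i.opens.toScheme
  map f := Hom.hom f

instance {i j : Chart sX A} (f : i ⟶ j) : IsOpenImmersion ((diagram sX A).map f) :=
  Hom.isOpenImmersion f

/-- An inclusion of charts is determined by the rational map `c⁻¹ * b` that it represents, so
there is at most one between two given charts; this makes the gluing of charts legitimate. -/
instance [hA : IsGermDetermined A] : Quiver.IsThin (Chart sX A) := fun i j ↦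
  ⟨fun f g ↦ Hom.ext (hA.hom_ext i.le j.le i.dense ((Hom.eq f).symm.trans (Hom.eq g)))⟩

/-- The inclusion of a smaller open subscheme with the same translation. -/
noncomputable def homOfLE (b : Bir sX) {U V : X.Opens} (h : U ≤ V) (hV : V ≤ A)
    (hU : Dense (U : Set X)) :
    (⟨b, U, h.trans hV, hU⟩ : Chart sX A) ⟶ ⟨b, V, hV, hU.mono h⟩ :=
  { hom := X.homOfLE h
    isOpenImmersion := inferInstance
    hom_comp := by simp
    eq := by
      rw [inv_mul_cancel]
      simp only [Scheme.homOfLE_ι, rationalMapOf_ι]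
      rfl : Hom _ _ }

/-- A chart contained in another one, when both lie in a third one. -/
noncomputable def lift {i j k : Chart sX A} (f : i ⟶ k) (g : j ⟶ k)
    (h : Set.range ((diagram sX A).map f) ⊆ Set.range ((diagram sX A).map g)) : i ⟶ j :=
  have : IsOpenImmersion g.hom := g.isOpenImmersion
  have : IsOpenImmersion f.hom := f.isOpenImmersion
  have hf : IsOpenImmersion.lift g.hom f.hom h ≫ g.hom = f.hom := IsOpenImmersion.lift_fac _ _ _
  have hi : IsOpenImmersion (IsOpenImmersion.lift g.hom f.hom h) := by
    have : IsOpenImmersion (IsOpenImmersion.lift g.hom f.hom h ≫ g.hom) := by rwa [hf]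
    exact IsOpenImmersion.of_comp _ g.hom
  have ho : IsOpenImmersion.lift g.hom f.hom h ≫ j.opens.ι ≫ sX = i.opens.ι ≫ sX := by
    rw [← g.hom_comp, reassoc_of% hf, f.hom_comp]
  { hom := IsOpenImmersion.lift g.hom f.hom h
    isOpenImmersion := hi
    hom_comp := ho
    eq := by
      let r : Bir sX := BirationalMap.ofOpenImmersion i.opens i.dense
        (IsOpenImmersion.lift g.hom f.hom h ≫ j.opens.ι) (by simpa using ho)
      have hr : (k.elt⁻¹ * j.elt) * r = k.elt⁻¹ * i.elt := by
        apply BirationalMap.ext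
        rw [f.eq]
        refine (BirationalMap.comp_toRationalMap_eq r _ rfl g.eq).trans ?_
        rw [reassoc_of% hf]
      have hr' : j.elt⁻¹ * i.elt = r := by
        rw [← mul_left_cancel_iff (a := k.elt⁻¹ * j.elt), hr]
        group
      rw [hr']
      rfl : Hom _ _ }

theorem lift_comp {i j k : Chart sX A} (f : i ⟶ k) (g : j ⟶ k)
    (h : Set.range ((diagram sX A).map f) ⊆ Set.range ((diagram sX A).map g)) :
    lift f g h ≫ g = f :=
  have : IsOpenImmersion g.hom := g.isOpenImmersion
  Hom.ext (IsOpenImmersion.lift_fac g.hom f.hom h)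

/-- Two charts inside a third one intersect, near any common point, in a chart: the charts
form a gluing diagram. -/
instance : ((diagram sX A) ⋙ Scheme.forget).IsLocallyDirected where
  cond {i j k} f g x y hxy := by
    change f.hom x = g.hom y at hxy
    have : IsOpenImmersion g.hom := g.isOpenImmersion
    have : IsOpenImmersion f.hom := f.isOpenImmersion
    let U : X.Opens := k.opens.ι ''ᵁ (f.hom.opensRange ⊓ g.hom.opensRange)
    have hUk : U ≤ k.opens := k.opens.ι_image_le _
    have hU : Dense (U : Set X) := U.2.dense ⟨_, f.hom x, ⟨⟨x, rfl⟩, ⟨y, hxy.symm⟩⟩, rfl⟩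
    let l : Chart sX A := ⟨k.elt, U, hUk.trans k.le, hU⟩
    let e : l ⟶ k := homOfLE k.elt hUk k.le hU
    have he : ∀ z : U.toScheme, X.homOfLE hUk z ∈ f.hom.opensRange ⊓ g.hom.opensRange :=
      homOfLE_mem_of_le_image le_rfl hUk
    have hef : Set.range ((diagram sX A).map e) ⊆ Set.range ((diagram sX A).map f) := by
      rintro _ ⟨z, rfl⟩
      exact (he z).1
    have heg : Set.range ((diagram sX A).map e) ⊆ Set.range ((diagram sX A).map g) := by
      rintro _ ⟨z, rfl⟩
      exact (he z).2
    let z : U.toScheme := ⟨_, f.hom x, ⟨⟨x, rfl⟩, ⟨y, hxy.symm⟩⟩, rfl⟩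
    have hz : X.homOfLE hUk z = f.hom x := Subtype.ext (Scheme.homOfLE_apply hUk z)
    refine ⟨l, lift e f hef, lift e g heg, z, ?_, ?_⟩
    · apply f.hom.isOpenEmbedding.injective
      change f.hom ((lift e f hef).hom z) = f.hom x
      rw [← Scheme.Hom.comp_apply, ← hz]
      exact congrArg (fun t : l ⟶ k ↦ t.hom z) (lift_comp e f hef)
    · apply g.hom.isOpenEmbedding.injective
      change g.hom ((lift e g heg).hom z) = g.hom y
      rw [← Scheme.Hom.comp_apply, ← hxy, ← hz]
      exact congrArg (fun t : l ⟶ k ↦ t.hom z) (lift_comp e g heg)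

/-- Any two charts overlap: a part of the first one is contained in the second one. -/
theorem exists_hom (i j : Chart sX A) :
    ∃ (U : X.Opens) (hU : U ≤ i.opens) (dU : Dense (U : Set X)),
      Nonempty ((⟨i.elt, U, hU.trans i.le, dU⟩ : Chart sX A) ⟶ j) := by
  obtain ⟨V, hV, m, hm, hmS, hb⟩ := (j.elt⁻¹ * i.elt).exists_eq_rationalMapOf
  have := nonempty_of_dense hV
  have hdom := isDominant_of_isOpenImmersion m
  -- the part of the domain of `j.elt⁻¹ * i.elt` that lies in `i.opens` and is sent to `j.opens`
  let U : X.Opens := V.ι ''ᵁ (m ⁻¹ᵁ j.opens) ⊓ i.opens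
  have hUV : U ≤ V := inf_le_left.trans (V.ι_image_le _)
  have hU : Dense (U : Set X) := by
    refine Dense.inter_of_isOpen_right ?_ i.dense i.opens.2
    obtain ⟨_, h1, x, rfl⟩ := hdom.1.inter_open_nonempty _ j.opens.2 j.dense.nonempty
    exact (V.ι ''ᵁ (m ⁻¹ᵁ j.opens)).2.dense ⟨_, x, h1, rfl⟩
  have hran : Set.range (X.homOfLE hUV ≫ m) ⊆ Set.range j.opens.ι := by
    rintro _ ⟨x, rfl⟩
    rw [Scheme.Opens.range_ι, Scheme.Hom.comp_apply]
    exact homOfLE_mem_of_le_image (W := m ⁻¹ᵁ j.opens) inf_le_left hUV x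
  have hfac : IsOpenImmersion.lift j.opens.ι (X.homOfLE hUV ≫ m) hran ≫ j.opens.ι =
    X.homOfLE hUV ≫ m := IsOpenImmersion.lift_fac _ _ _
  have hi : IsOpenImmersion (IsOpenImmersion.lift j.opens.ι (X.homOfLE hUV ≫ m) hran) := by
    have : IsOpenImmersion (IsOpenImmersion.lift j.opens.ι (X.homOfLE hUV ≫ m) hran ≫
      j.opens.ι) := by rw [hfac]; infer_instance
    exact IsOpenImmersion.of_comp _ j.opens.ι
  refine ⟨U, inf_le_right, hU, ⟨(⟨_, hi, ?_, ?_⟩ : Hom _ _)⟩⟩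
  · rw [reassoc_of% hfac, hmS, Scheme.homOfLE_ι_assoc]
  · rw [hfac, rationalMapOf_homOfLE_comp hU hV]
    exact hb

end Chart

end Chart

/-! ### The globalization -/

section Globalization

variable {S X : Scheme.{u}} [IrreducibleSpace X] (sX : X ⟶ S) (A : X.Opens)
  [hA : IsGermDetermined A]

/-- The globalization of the action of `Bir(X)` on `X`: the scheme, in general neither separated
nor quasi-compact, glued from all translates of the open subscheme `A` of `X` along the largest
open subschemes where they can be identified. -/
noncomputable def globalization : Scheme.{u} :=
  colimit (Chart.diagram sX A)

namespace Chart

variable {sX A}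

/-- The open immersion of a chart into the globalization. -/
noncomputable def ι (i : Chart sX A) : i.opens.toScheme ⟶ globalization sX A :=
  colimit.ι (diagram sX A) i

instance (i : Chart sX A) : IsOpenImmersion i.ι :=
  inferInstanceAs (IsOpenImmersion (colimit.ι (diagram sX A) i))

theorem hom_ι {i j : Chart sX A} (f : i ⟶ j) : f.hom ≫ j.ι = i.ι :=
  colimit.w (diagram sX A) f

instance (i : Chart sX A) : Nonempty i.opens.toScheme := nonempty_of_dense i.dense

/-- The translate of a chart by a birational transformation. -/
noncomputable abbrev translate (b : Bir sX) (i : Chart sX A) : Chart sX A :=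
  ⟨b * i.elt, i.opens, i.le, i.dense⟩

/-- Translation preserves inclusions of charts. -/
noncomputable def translateMap (b : Bir sX) {i j : Chart sX A} (f : i ⟶ j) :
    translate b i ⟶ translate b j :=
  { hom := f.hom
    isOpenImmersion := f.isOpenImmersion
    hom_comp := f.hom_comp
    eq := by
      have h : (translate b j).elt⁻¹ * (translate b i).elt = j.elt⁻¹ * i.elt := by
        change (b * j.elt)⁻¹ * (b * i.elt) = _
        group
      exact (congrArg _ h).trans f.eq : Hom (translate b i) (translate b j) }

theorem ι_congr {b c : Bir sX} (h : b = c) {U : X.Opens} (hU : U ≤ A) (dU : Dense (U : Set X)) :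
    (⟨b, U, hU, dU⟩ : Chart sX A).ι = (⟨c, U, hU, dU⟩ : Chart sX A).ι := by
  subst h
  rfl

variable (sX A) in
/-- The untranslated chart `A`. -/
noncomputable def base : Chart sX A := ⟨1, A, le_rfl, hA.dense⟩

end Chart

namespace globalization

variable {sX A}

theorem hom_ext {T : Scheme.{u}} {f g : globalization sX A ⟶ T}
    (h : ∀ i : Chart sX A, i.ι ≫ f = i.ι ≫ g) : f = g :=
  colimit.hom_ext h

theorem exists_chart (z : globalization sX A) : ∃ (i : Chart sX A) (x : i.opens.toScheme),
    i.ι x = z :=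
  Scheme.IsLocallyDirected.ι_jointly_surjective (Chart.diagram sX A) z

variable (sX A) in
/-- The structure morphism of the globalization. -/
noncomputable def structureMap : globalization sX A ⟶ S :=
  colimit.desc (Chart.diagram sX A)
    { pt := S
      ι :=
        { app := fun i ↦ i.opens.ι ≫ sX
          naturality := fun i j f ↦ by
            exact (Chart.Hom.hom_comp f).trans (Category.comp_id _).symm } }

theorem ι_structureMap (i : Chart sX A) : i.ι ≫ structureMap sX A = i.opens.ι ≫ sX :=
  colimit.ι_desc _ _

/-- The automorphism of the globalization given by a birational transformation. -/
noncomputable def actionHom (b : Bir sX) : globalization sX A ⟶ globalization sX A :=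
  colimit.desc (Chart.diagram sX A)
    { pt := globalization sX A
      ι :=
        { app := fun i ↦ (i.translate b).ι
          naturality := fun i j f ↦ by
            exact (Chart.hom_ι (Chart.translateMap b f)).trans (Category.comp_id _).symm } }

theorem ι_actionHom (b : Bir sX) (i : Chart sX A) : i.ι ≫ actionHom b = (i.translate b).ι :=
  colimit.ι_desc _ _

theorem actionHom_one : actionHom (1 : Bir sX) = 𝟙 (globalization sX A) :=
  hom_ext fun i ↦ by
    rw [ι_actionHom, Category.comp_id]
    exact Chart.ι_congr (one_mul _) _ _

theorem actionHom_mul (b c : Bir sX) :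
    (actionHom (b * c) : globalization sX A ⟶ _) = actionHom c ≫ actionHom b :=
  hom_ext fun i ↦ by
    have h : i.ι ≫ actionHom c ≫ actionHom b = ((i.translate c).translate b).ι :=
      (reassoc_of% ι_actionHom c i) _ |>.trans (ι_actionHom b _)
    rw [ι_actionHom, h]
    exact Chart.ι_congr (mul_assoc _ _ _) _ _

theorem actionHom_structureMap (b : Bir sX) :
    actionHom b ≫ structureMap sX A = structureMap sX A :=
  hom_ext fun i ↦ by
    rw [← Category.assoc, ι_actionHom]
    exact (ι_structureMap (i.translate b)).trans (ι_structureMap i).symm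

variable (sX A) in
/-- The action of `Bir(X)` on the globalization. -/
noncomputable def action : Bir sX →* Aut (Over.mk (structureMap sX A)) where
  toFun b :=
    { hom := Over.homMk (actionHom b) (actionHom_structureMap b)
      inv := Over.homMk (actionHom b⁻¹) (actionHom_structureMap b⁻¹)
      hom_inv_id := by
        ext1
        exact (actionHom_mul b⁻¹ b).symm.trans (by rw [inv_mul_cancel, actionHom_one]; rfl)
      inv_hom_id := by
        ext1
        exact (actionHom_mul b b⁻¹).symm.trans (by rw [mul_inv_cancel, actionHom_one]; rfl) }
  map_one' := by
    ext1; ext1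
    exact actionHom_one
  map_mul' b c := by
    ext1; ext1
    exact actionHom_mul b c

variable (sX A) in
/-- The untranslated copy of `A` in the globalization. -/
noncomputable def ofOpen : A.toScheme ⟶ globalization sX A := (Chart.base sX A).ι

instance : IsOpenImmersion (ofOpen sX A) := inferInstanceAs (IsOpenImmersion (Chart.base sX A).ι)

theorem ofOpen_structureMap : ofOpen sX A ≫ structureMap sX A = A.ι ≫ sX :=
  ι_structureMap (Chart.base sX A)

/-- The translates of `A` cover the globalization. -/
theorem exists_actionHom_ofOpen (z : globalization sX A) :
    ∃ (b : Bir sX) (x : A.toScheme), actionHom b (ofOpen sX A x) = z := by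
  obtain ⟨i, x, rfl⟩ := exists_chart z
  refine ⟨i.elt, X.homOfLE i.le x, ?_⟩
  have h1 : ofOpen sX A ≫ actionHom i.elt =
      (⟨i.elt, A, le_rfl, hA.dense⟩ : Chart sX A).ι :=
    (ι_actionHom i.elt (Chart.base sX A)).trans (Chart.ι_congr (mul_one _) _ _)
  have h2 : X.homOfLE i.le ≫ ofOpen sX A ≫ actionHom i.elt = i.ι := by
    rw [h1]
    exact Chart.hom_ι (Chart.homOfLE i.elt i.le le_rfl i.dense)
  rw [← h2]
  rfl

/-- Any two charts share a dense open part, by `Chart.exists_hom`, so any two nonempty open sets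
meet inside a single irreducible chart. -/
instance : IrreducibleSpace (globalization sX A) := by
  have hne : Nonempty (globalization sX A) :=
    ⟨(Chart.base sX A).ι (Classical.arbitrary (Chart.base sX A).opens.toScheme)⟩
  have hirr : ∀ l : Chart sX A, PreirreducibleSpace l.opens.toScheme := fun l ↦
    l.opens.ι.isOpenEmbedding.preirreducibleSpace
  refine @IrreducibleSpace.mk _ _ ⟨?_⟩ hne
  rintro U V hU hV ⟨x, -, hx⟩ ⟨y, -, hy⟩
  obtain ⟨i, x, rfl⟩ := exists_chart x
  obtain ⟨j, y, rfl⟩ := exists_chart y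
  obtain ⟨W, hW, dW, ⟨g⟩⟩ := Chart.exists_hom i j
  have hmem : ∀ {k l : Chart sX A} (f : k ⟶ l) {O : Set (globalization sX A)}, IsOpen O →
      ∀ x : l.opens.toScheme, l.ι x ∈ O → (k.ι ⁻¹' O).Nonempty := by
    intro k l f O hO x hx
    have : IsOpenImmersion f.hom := f.isOpenImmersion
    obtain ⟨_, h, w, rfl⟩ := (isDominant_of_isOpenImmersion f.hom).1.inter_open_nonempty
      (l.ι ⁻¹' O) (hO.preimage l.ι.continuous) ⟨x, hx⟩
    refine ⟨w, ?_⟩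
    rw [Set.mem_preimage, ← Chart.hom_ι f]
    exact h
  obtain ⟨w, hw⟩ := nonempty_preirreducible_inter (hU.preimage (Chart.ι _).continuous)
    (hV.preimage (Chart.ι _).continuous)
    (hmem (Chart.homOfLE i.elt hW i.le dW) hU x hx) (hmem g hV y hy)
  exact ⟨_, trivial, hw⟩

theorem locallyOfFiniteType_structureMap [LocallyOfFiniteType sX] :
    LocallyOfFiniteType (structureMap sX A) := by
  have : IsZariskiLocalAtSource @LocallyOfFiniteType.{u} :=
    HasRingHomProperty.instIsZariskiLocalAtSource
  refine (IsZariskiLocalAtSource.iff_of_openCover (P := @LocallyOfFiniteType)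
    (Scheme.IsLocallyDirected.openCover (Chart.diagram sX A))).2 fun i ↦ ?_
  change Chart sX A at i
  have h : LocallyOfFiniteType (i.opens.ι ≫ sX) := inferInstance
  rwa [← ι_structureMap i] at h

/-- The rational map `X ⇢ globalization` given by the inclusion of `A` is equivariant: on the part
of `A` which `b` maps into `A`, the chart translated by `b` is identified with the untranslated
one. -/
theorem comp_ofOpen (b : Bir sX) :
    (b.comp (BirationalMap.ofOpenImmersion A hA.dense (ofOpen sX A)
      ofOpen_structureMap)).toRationalMap =
    rationalMapOf A hA.dense (ofOpen sX A ≫ actionHom b) := by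
  obtain ⟨U, hU, dU, ⟨g⟩⟩ := Chart.exists_hom ((Chart.base sX A).translate b) (Chart.base sX A)
  have hUA : U ≤ A := hU
  have hb : b.toRationalMap = rationalMapOf U dU (g.hom ≫ A.ι) := by
    have h : (Chart.base sX A).elt⁻¹ * ((Chart.base sX A).translate b).elt = b := by
      change 1⁻¹ * (b * 1) = b
      group
    exact (congrArg _ h.symm).trans g.eq
  have key : g.hom ≫ ofOpen sX A = X.homOfLE hUA ≫ ofOpen sX A ≫ actionHom b :=
    (Chart.hom_ι g).trans ((Chart.hom_ι (Chart.homOfLE (b * 1) hUA le_rfl dU)).symm.trans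
      (congrArg (X.homOfLE hUA ≫ ·) (ι_actionHom b (Chart.base sX A)).symm))
  refine (BirationalMap.comp_toRationalMap_eq _ _ hb (n := ofOpen sX A) (hV := hA.dense)
    rfl).trans ?_
  exact (congrArg (rationalMapOf U dU) key).trans (rationalMapOf_homOfLE_comp dU hA.dense hUA _)

end globalization

end Globalization

/-! ### A criterion for separatedness -/

section Separated

variable {S X Y Z : Scheme.{u}}

/-- If any two points of `Y` lie in a common open subscheme that is separated over `S`, then `Y`
is separated over `S`: the diagonal is closed inside each open subset `V ×[S] V` of `Y ×[S] Y`,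
and these subsets cover. -/
theorem isSeparated_of_forall_exists_isSeparated (f : Y ⟶ S)
    (h : ∀ x y : Y, ∃ V : Y.Opens, x ∈ V ∧ y ∈ V ∧ IsSeparated (V.ι ≫ f)) : IsSeparated f := by
  refine ⟨IsClosedImmersion.of_isPreimmersion _ ?_⟩
  rw [← isOpen_compl_iff, isOpen_iff_forall_mem_open]
  intro p hp
  obtain ⟨V, h1, h2, hV⟩ := h (pullback.fst f f p) (pullback.snd f f p)
  let j : pullback (V.ι ≫ f) (V.ι ≫ f) ⟶ pullback f f :=
    pullback.map _ _ _ _ V.ι V.ι (𝟙 S) (by simp) (by simp)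
  have hj : IsOpenImmersion j := inferInstance
  have hj1 : j ≫ pullback.fst f f = pullback.fst _ _ ≫ V.ι := pullback.lift_fst _ _ _
  have hj2 : j ≫ pullback.snd f f = pullback.snd _ _ ≫ V.ι := pullback.lift_snd _ _ _
  have hdiag : V.ι ≫ pullback.diagonal f = pullback.diagonal (V.ι ≫ f) ≫ j := by
    apply pullback.hom_ext <;> simp [hj1, hj2]
  have hcl : IsClosed (Set.range (pullback.diagonal (V.ι ≫ f))) :=
    (pullback.diagonal (V.ι ≫ f)).isClosedEmbedding.isClosed_range
  refine ⟨j '' (Set.range (pullback.diagonal (V.ι ≫ f)))ᶜ, ?_,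
    j.isOpenEmbedding.isOpenMap _ hcl.isOpen_compl, ?_⟩
  · rintro _ ⟨q, hq, rfl⟩ ⟨y, hy⟩
    have hyV : y = V.ι (pullback.fst (V.ι ≫ f) (V.ι ≫ f) q) := by
      have e1 : pullback.fst f f (pullback.diagonal f y) = y := by
        rw [← Scheme.Hom.comp_apply, pullback.diagonal_fst]
        rfl
      rw [← e1, hy, ← Scheme.Hom.comp_apply, ← Scheme.Hom.comp_apply, hj1]
    refine hq ⟨pullback.fst (V.ι ≫ f) (V.ι ≫ f) q, j.isOpenEmbedding.injective ?_⟩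
    rw [← hy, hyV]
    exact (congrArg (fun t ↦ t (pullback.fst (V.ι ≫ f) (V.ι ≫ f) q)) hdiag).symm
  · have hr : p ∈ Set.range j := by
      rw [Scheme.Pullback.range_map]
      exact ⟨⟨⟨_, h1⟩, rfl⟩, ⟨⟨_, h2⟩, rfl⟩⟩
    obtain ⟨q, rfl⟩ := hr
    refine ⟨q, ?_, rfl⟩
    rintro ⟨v, rfl⟩
    exact hp ⟨V.ι v, by rw [← Scheme.Hom.comp_apply, ← Scheme.Hom.comp_apply, hdiag]⟩

theorem isSeparated_of_forall_exists_isAffineOpen (s : Z ⟶ S) (Y : Z.Opens)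
    (h : ∀ x ∈ Y, ∀ y ∈ Y, ∃ V : Z.Opens, x ∈ V ∧ y ∈ V ∧ IsAffineOpen V) :
    IsSeparated (Y.ι ≫ s) := by
  refine isSeparated_of_forall_exists_isSeparated _ fun x y ↦ ?_
  obtain ⟨V, hx, hy, hV⟩ := h x.1 x.2 y.1 y.2
  refine ⟨Y.ι ⁻¹ᵁ V, hx, hy, ?_⟩
  have : IsAffine V.toScheme := hV
  have hran : Set.range ((Y.ι ⁻¹ᵁ V).ι ≫ Y.ι) ⊆ Set.range V.ι := by
    rintro _ ⟨z, rfl⟩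
    rw [Scheme.Opens.range_ι, Scheme.Hom.comp_apply]
    exact z.2
  have hl := IsOpenImmersion.lift_fac V.ι ((Y.ι ⁻¹ᵁ V).ι ≫ Y.ι) hran
  have : Mono (IsOpenImmersion.lift V.ι ((Y.ι ⁻¹ᵁ V).ι ≫ Y.ι) hran) :=
    have : Mono (IsOpenImmersion.lift V.ι ((Y.ι ⁻¹ᵁ V).ι ≫ Y.ι) hran ≫ V.ι) := by
      rw [hl]; infer_instance
    mono_of_mono _ V.ι
  rw [← Category.assoc, ← hl, Category.assoc]
  infer_instance

/-! ### Boundedness of codimension -/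

theorem exists_ringKrullDim_le_of_finiteType {k : Type u} [Field k] {R : Type v} [CommRing R]
    (f : k →+* R) (hf : f.FiniteType) : ∃ n : ℕ, ringKrullDim R ≤ n := by
  algebraize [f]
  obtain ⟨n, g, hg⟩ := Algebra.FiniteType.iff_quotient_mvPolynomial''.1
    (inferInstance : Algebra.FiniteType k R)
  refine ⟨n, (ringKrullDim_le_of_surjective g.toRingHom hg).trans ?_⟩
  rw [MvPolynomial.ringKrullDim_of_isNoetherianRing, ringKrullDim_eq_zero_of_field]
  simp

/-- The points of a scheme are ordered by specialization with the generic point on top, so that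
the coheight of a point is its codimension. On an affine scheme of finite type over a field it is
bounded by the Krull dimension. -/
theorem exists_coheight_le_of_isAffine {k : Type u} [Field k] [IsAffine X]
    (s : X ⟶ Spec (CommRingCat.of k)) [LocallyOfFiniteType s] :
    ∃ n : ℕ, ∀ x : X, Order.coheight x ≤ n := by
  have h : s.appTop.hom.FiniteType :=
    (HasRingHomProperty.iff_of_isAffine (P := @LocallyOfFiniteType)).1 ‹_›
  let e : k ≃+* Γ(Spec (CommRingCat.of k), ⊤) :=
    (Scheme.ΓSpecIso (CommRingCat.of k)).symm.commRingCatIsoToRingEquiv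
  have h' : (s.appTop.hom.comp e.toRingHom).FiniteType :=
    h.comp (RingHom.FiniteType.of_surjective _ e.surjective)
  obtain ⟨n, hn⟩ := exists_ringKrullDim_le_of_finiteType _ h'
  refine ⟨n, fun x ↦ ?_⟩
  rw [← coheight_eq_of_isOpenImmersion X.isoSpec.hom, ← idealHeight_eq_coheight]
  have := (Ideal.height_le_ringKrullDim_of_ne_top
    (PrimeSpectrum.isPrime (X.isoSpec.hom x)).ne_top).trans hn
  exact_mod_cast this

/-! ### Restriction to a stable open subscheme -/

section Restrict

variable {H : Type v} [Group H] {s : Z ⟶ S} (r : H →* Aut (Over.mk s)) (Y : Z.Opens)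
  (hY : ∀ h : H, ∀ z ∈ Y, (r h).hom.left z ∈ Y)

/-- The restriction of an automorphism to a stable open subscheme. -/
noncomputable def restrictHom (h : H) : Y.toScheme ⟶ Y.toScheme :=
  IsOpenImmersion.lift Y.ι (Y.ι ≫ (r h).hom.left) (by
    rintro _ ⟨z, rfl⟩
    rw [Scheme.Opens.range_ι, Scheme.Hom.comp_apply]
    exact hY h z.1 z.2)

theorem restrictHom_ι (h : H) : restrictHom r Y hY h ≫ Y.ι = Y.ι ≫ (r h).hom.left :=
  IsOpenImmersion.lift_fac _ _ _

theorem restrictHom_one : restrictHom r Y hY 1 = 𝟙 _ := by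
  rw [← cancel_mono Y.ι, restrictHom_ι, map_one, Category.id_comp]
  exact Category.comp_id _

theorem restrictHom_mul (g h : H) :
    restrictHom r Y hY (g * h) = restrictHom r Y hY h ≫ restrictHom r Y hY g := by
  rw [← cancel_mono Y.ι, restrictHom_ι, map_mul, Category.assoc, restrictHom_ι, ← Category.assoc,
    restrictHom_ι, Category.assoc]
  rfl

theorem restrictHom_comp (h : H) : restrictHom r Y hY h ≫ Y.ι ≫ s = Y.ι ≫ s := by
  rw [← Category.assoc, restrictHom_ι, Category.assoc]
  exact congrArg _ (Over.w (r h).hom)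

/-- The restriction of a group action to a stable open subscheme. -/
noncomputable def restrictAction : H →* Aut (Over.mk (Y.ι ≫ s)) where
  toFun h :=
    { hom := Over.homMk (restrictHom r Y hY h) (restrictHom_comp r Y hY h)
      inv := Over.homMk (restrictHom r Y hY h⁻¹) (restrictHom_comp r Y hY h⁻¹)
      hom_inv_id := by
        ext1
        exact (restrictHom_mul r Y hY h⁻¹ h).symm.trans
          (by rw [inv_mul_cancel, restrictHom_one]; rfl)
      inv_hom_id := by
        ext1
        exact (restrictHom_mul r Y hY h h⁻¹).symm.trans
          (by rw [mul_inv_cancel, restrictHom_one]; rfl) }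
  map_one' := by
    ext1; ext1
    exact restrictHom_one r Y hY
  map_mul' g h := by
    ext1; ext1
    exact restrictHom_mul r Y hY g h

theorem restrictAction_hom_left_ι (h : H) :
    (restrictAction r Y hY h).hom.left ≫ Y.ι = Y.ι ≫ (r h).hom.left :=
  restrictHom_ι r Y hY h

end Restrict

theorem BirationalMap.comp_ofIso {S X Y Z : Scheme.{u}} [IrreducibleSpace X] [IrreducibleSpace Y]
    {sX : X ⟶ S} {sY : Y ⟶ S} {sZ : Z ⟶ S} (f : BirationalMap sX sY)
    (e : Over.mk sY ≅ Over.mk sZ) :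
    (f.comp (BirationalMap.ofIso e)).toRationalMap = f.toRationalMap.compHom e.hom.left :=
  Scheme.RationalMap.comp_toRationalMap _ _

theorem comp_compHom {T : Scheme.{u}} [IrreducibleSpace X] [IrreducibleSpace Y] [Nonempty Z]
    (f : X ⤏ Y) [f.IsDominant] (g : Y ⤏ Z) [g.IsDominant] (h : Z ⟶ T) :
    (f.comp g).compHom h = f.comp (g.compHom h) := by
  rw [← Scheme.RationalMap.comp_toRationalMap, Scheme.RationalMap.comp_assoc,
    Scheme.RationalMap.comp_toRationalMap]

end Separated

/-! ### The equivariant model -/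

/-- A stable noetherian open set `U` is covered by finitely many affine open sets `V x`; let `W ⊆
U` be their intersection inside `U`. If `x` and `y` lie in translates of `W`, move `x` into `W`;
then `y` is moved into some `V i`, which also contains the image of `x`. Hence any two points of
the union `Y` of all translates of `W` lie in a common affine open set. -/
theorem exists_stable_separating_open {Z : Scheme.{u}} {G : Type v} [Group G] [MulAction G Z]
    (hact : ∀ g : G, ∃ f : Z ⟶ Z, IsIso f ∧ ∀ z, f z = g • z)
    {U : Set Z} (hU : IsOpen U) [NoetherianSpace U] {η : Z} (hη : ∀ x, η ⤳ x) (hηU : η ∈ U)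
    (hst : ∀ (g : G), ∀ x ∈ U, g • x ∈ U) :
    ∃ Y : Z.Opens, (Y : Set Z) ⊆ U ∧ η ∈ Y ∧ (∀ (g : G), ∀ x ∈ Y, g • x ∈ Y) ∧
      ∀ x ∈ Y, ∀ y ∈ Y, ∃ V : Z.Opens, x ∈ V ∧ y ∈ V ∧ IsAffineOpen V := by
  have hcont : ∀ g : G, Continuous fun z : Z ↦ g • z := by
    intro g
    obtain ⟨f, -, hf⟩ := hact g
    simpa only [← hf] using f.continuous
  have haff : ∀ x : U, ∃ V : Z.Opens, x.1 ∈ V ∧ IsAffineOpen V := by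
    intro x
    obtain ⟨V, hV, hx, -⟩ := exists_isAffineOpen_mem_and_subset
      (TopologicalSpace.Opens.mem_top x.1)
    exact ⟨V, hx, hV⟩
  choose V hxV hV using haff
  have hcpt : IsCompact U := isCompact_iff_compactSpace.2 inferInstance
  obtain ⟨t, ht⟩ := hcpt.elim_finite_subcover (fun x : U ↦ (V x : Set Z)) (fun x ↦ (V x).2)
    fun x hx ↦ Set.mem_iUnion.2 ⟨⟨x, hx⟩, hxV _⟩
  let W : Set Z := U ∩ ⋂ x ∈ t, (V x : Set Z)
  have hW : IsOpen W := hU.inter (isOpen_biInter_finset fun x _ ↦ (V x).2)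
  have hηW : η ∈ W :=
    ⟨hηU, Set.mem_iInter₂.2 fun x _ ↦ (hη x.1).mem_open (V x).2 (hxV x)⟩
  let Y : Z.Opens := ⟨⋃ g : G, (g • ·) ⁻¹' W, isOpen_iUnion fun g ↦ hW.preimage (hcont g)⟩
  have hmem : ∀ x : Z, x ∈ Y ↔ ∃ g : G, g • x ∈ W := fun x ↦ Set.mem_iUnion
  have hYU : (Y : Set Z) ⊆ U := by
    intro x hx
    obtain ⟨g, hg⟩ := (hmem x).1 hx
    simpa using hst g⁻¹ _ hg.1
  refine ⟨Y, hYU, (hmem η).2 ⟨1, by rwa [one_smul]⟩, ?_, ?_⟩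
  · intro g x hx
    obtain ⟨h, hh⟩ := (hmem x).1 hx
    exact (hmem _).2 ⟨h * g⁻¹, by rwa [smul_smul, inv_mul_cancel_right]⟩
  · intro x hx y hy
    obtain ⟨g, hg⟩ := (hmem x).1 hx
    obtain ⟨i, hi, hyi⟩ := Set.mem_iUnion₂.1 (ht (hst g y (hYU hy)))
    obtain ⟨f, _, hf⟩ := hact g
    refine ⟨f ⁻¹ᵁ V i, ?_, ?_, (hV i).preimage_of_isIso f⟩
    · change f x ∈ V i
      rw [hf]
      exact Set.mem_iInter₂.1 hg.2 i hi
    · change f y ∈ V i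
      rw [hf]
      exact hyi

section Model

variable {S X : Scheme.{u}} [IrreducibleSpace X] {sX : X ⟶ S} {A : X.Opens}
  [hA : IsGermDetermined A]

/-- For a nonempty stable open subscheme `Y` of the globalization, the inclusion of `A` induces an
equivariant birational transformation from `X` to `Y`, defined where `A` meets `Y`. -/
theorem exists_birationalMap_restrictAction {G : Type v} [Group G] (φ : G →* Bir sX)
    (Y : (globalization sX A).Opens) [IrreducibleSpace Y.toScheme]
    (hY : ∀ g : G, ∀ z ∈ Y, (((globalization.action sX A).comp φ) g).hom.left z ∈ Y) :
    ∃ u : BirationalMap sX (Y.ι ≫ globalization.structureMap sX A),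
      ∀ g : G, (φ g).comp u = u.comp (BirationalMap.ofIso
        (restrictAction ((globalization.action sX A).comp φ) Y hY g)) := by
  let j := globalization.ofOpen sX A
  let U : X.Opens := A.ι ''ᵁ (j ⁻¹ᵁ Y)
  have hUA : U ≤ A := A.ι_image_le _
  have : Nonempty A.toScheme := nonempty_of_dense hA.dense
  have hU : Dense (U : Set X) := by
    have hj := isDominant_of_isOpenImmersion j
    obtain ⟨y⟩ := (inferInstance : Nonempty Y.toScheme)
    obtain ⟨_, h1, x, rfl⟩ := hj.1.inter_open_nonempty _ Y.2 ⟨_, y.2⟩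
    exact U.2.dense ⟨_, x, h1, rfl⟩
  have hran : Set.range (X.homOfLE hUA ≫ j) ⊆ Set.range Y.ι := by
    rintro _ ⟨x, rfl⟩
    rw [Scheme.Opens.range_ι, Scheme.Hom.comp_apply]
    exact homOfLE_mem_of_le_image (W := j ⁻¹ᵁ Y) le_rfl hUA x
  let m := IsOpenImmersion.lift Y.ι (X.homOfLE hUA ≫ j) hran
  have hm : m ≫ Y.ι = X.homOfLE hUA ≫ j := IsOpenImmersion.lift_fac _ _ _
  have hmo : IsOpenImmersion m := by
    have : IsOpenImmersion (m ≫ Y.ι) := by rw [hm]; infer_instance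
    exact IsOpenImmersion.of_comp _ Y.ι
  have hmS : m ≫ Y.ι ≫ globalization.structureMap sX A = U.ι ≫ sX := by
    rw [← Category.assoc, hm, Category.assoc, globalization.ofOpen_structureMap,
      Scheme.homOfLE_ι_assoc]
  let u := BirationalMap.ofOpenImmersion U hU m hmS
  have hu : u.toRationalMap.compHom Y.ι = rationalMapOf A hA.dense j := by
    change rationalMapOf U hU (m ≫ Y.ι) = _
    rw [hm, rationalMapOf_homOfLE_comp hU hA.dense hUA]
  -- equality of rational maps to `Y` can be tested after the inclusion into the globalization,
  -- where it is `globalization.comp_ofOpen`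
  refine ⟨u, fun g ↦ BirationalMap.ext (compHom_injective_of_mono Y.ι ?_)⟩
  change ((φ g).toRationalMap.comp u.toRationalMap).compHom Y.ι = Scheme.RationalMap.compHom _ _
  refine Eq.trans ?_ (congrArg (Scheme.RationalMap.compHom · Y.ι)
    (BirationalMap.comp_ofIso u (restrictAction _ Y hY g)).symm)
  rw [comp_compHom, hu, compHom_compHom, restrictAction_hom_left_ι, ← compHom_compHom, hu]
  exact globalization.comp_ofOpen (φ g)

end Model

theorem theorem1p1 {k : Type u} [Field k]
    {X : Scheme.{u}} [IrreducibleSpace X] (sX : X ⟶ Spec (CommRingCat.of k)) (hX : IsVariety sX)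
    {G : Type v} [Group G] (hG : PropertyFW.{v, max u v} G) (φ : G →* Bir sX) :
    ∃ (Y : Scheme.{u}) (_ : IrreducibleSpace Y) (sY : Y ⟶ Spec (CommRingCat.of k)),
      IsVariety sY ∧
      ∃ (ρ : G →* Aut (Over.mk sY)) (u : BirationalMap sX sY),
        ∀ g : G, (φ g).comp u = u.comp (BirationalMap.ofIso (ρ g)) := by
  have := hX.locallyOfFiniteType
  have : IsLocallyNoetherian X := LocallyOfFiniteType.isLocallyNoetherian sX
  obtain ⟨A, hA⟩ := exists_isGermDetermined X
  have : IsAffine A.toScheme := hA.isAffineOpen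
  let Z := globalization sX A
  let s : Z ⟶ Spec (CommRingCat.of k) := globalization.structureMap sX A
  have hs : LocallyOfFiniteType s := globalization.locallyOfFiniteType_structureMap
  let r : G →* Aut (Over.mk s) := (globalization.action sX A).comp φ
  let j : A.toScheme ⟶ Z := globalization.ofOpen sX A
  have hiso : ∀ b : Bir sX, IsIso (globalization.actionHom b : Z ⟶ Z) := fun b ↦
    inferInstanceAs (IsIso ((Over.forget _).mapIso (globalization.action sX A b)).hom)
  -- the action is introduced on the points of `Z`, in the form needed for Property FW
  let _ : MulAction G Z :=
    { smul g z := globalization.actionHom (φ g) z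
      one_smul z := by
        change globalization.actionHom (φ 1) z = z
        rw [map_one, globalization.actionHom_one]
        rfl
      mul_smul g h z := by
        change globalization.actionHom (φ (g * h)) z = _
        rw [map_mul, globalization.actionHom_mul]
        rfl }
  have hsmul : ∀ (g : G) (z : Z), g • z = globalization.actionHom (φ g) z := fun _ _ ↦ rfl
  have : ContinuousConstSMul G Z := ⟨fun g ↦ (globalization.actionHom (φ g)).continuous⟩
  obtain ⟨n, hn⟩ := exists_coheight_le_of_isAffine (A.ι ≫ sX)
  -- codimension is a local notion and every point has a translate in `A`, so the bound
  -- for `A` holds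
  have hnZ : ∀ z : Z, Order.coheight z ≤ n := by
    intro z
    obtain ⟨b, x, rfl⟩ := globalization.exists_actionHom_ofOpen z
    have := hiso b
    exact (coheight_eq_of_isOpenImmersion (globalization.actionHom b)).trans_le
      ((coheight_eq_of_isOpenImmersion j).trans_le (hn x))
  have hfin : ∀ z : Z, Order.coheight z ≠ ⊤ := fun z ↦ ne_top_of_le_ne_top (by simp) (hnZ z)
  have : Nonempty A.toScheme := nonempty_of_dense hA.dense
  have : IsNoetherianRing Γ(X, A) := IsLocallyNoetherian.component_noetherian ⟨A, hA.isAffineOpen⟩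
  have : NoetherianSpace A.toScheme := noetherianSpace_of_isAffineOpen A hA.isAffineOpen
  have : NoetherianSpace (Set.range j) := NoetherianSpace.range j j.continuous
  obtain ⟨U, hU, _, hηU, hst⟩ := exists_open_stable (G := G) hG
    (c := fun z : Z ↦ (Order.coheight z).toNat) (n := n)
    (fun z ↦ ENat.toNat_le_of_le_natCast (hnZ z))
    (fun x y hxy hne ↦ by
      have hle : y ≤ x := hxy
      have hlt : y < x := lt_of_le_not_ge hle fun h ↦ hne (Specializes.antisymm hxy h).eq
      rw [← ENat.natCast_lt_natCast, ENat.natCast_toNat (hfin _), ENat.natCast_toNat (hfin _)]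
      exact Order.coheight_strictAnti hlt (lt_top_iff_ne_top.2 (hfin _)))
    (fun g z ↦ by
      have := hiso (φ g)
      exact congrArg ENat.toNat (coheight_eq_of_isOpenImmersion (globalization.actionHom (φ g))))
    (η := genericPoint Z) genericPoint_specializes (U := Set.range j) j.isOpenEmbedding.isOpen_range
    ((genericPoint_specializes _).mem_open j.isOpenEmbedding.isOpen_range
      (Set.range_nonempty j).choose_spec)
  obtain ⟨Y, hYU, hηY, hYst, hYaff⟩ := exists_stable_separating_open (G := G)
    (fun g ↦ ⟨globalization.actionHom (φ g), hiso _, fun z ↦ (hsmul g z).symm⟩) hU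
    genericPoint_specializes hηU hst
  have hYne : Nonempty Y.toScheme := ⟨⟨_, hηY⟩⟩
  have hYirr : IrreducibleSpace Y.toScheme :=
    Y.ι.isOpenEmbedding.irreducibleSpace
  have hYN : NoetherianSpace Y.toScheme := NoetherianSpace.of_subset hYU
  obtain ⟨u, hu⟩ := exists_birationalMap_restrictAction φ Y hYst
  exact ⟨Y.toScheme, hYirr, Y.ι ≫ s,
    ⟨inferInstance, isSeparated_of_forall_exists_isAffineOpen s Y hYaff, inferInstance⟩,
    restrictAction r Y hYst, u, hu⟩
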